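/- Let $k$ be a field of characteristic zero, $n\ge 1$, $P_n=k[x_1,\dots,x_n]$ and $\partial_i=\partial/\partial x_i$. Let $\mathscr L_n$ be the left-symmetric Witt algebra, i.e. the space of all derivations of $P_n$ with the bilinear product determined by $a\partial_i\cdot b\partial_j=(a\,\partial_i(b))\,\partial_j$ for $a,b\in P_n$, and let $ST(\mathscr L_n)\subseteq\mathscr L_n$ be the subalgebra of strongly triangular derivations, i.e. the $k$-span of the derivations $x_{i+1}^{s_{i+1}}\cdots x_n^{s_n}\partial_i$ with $1\le i\le n$ and $s_{i+1},\dots,s_n\ge 0$. A left-symmetric polynomial is an element $g$ of a free left-symmetric $k$-algebra $LS\langle z_1,\dots,z_m\rangle$ (left-symmetric: $(xy)z-x(yz)=(yx)z-y(xz)$); its degree is the least $d$ such that $g$ is a linear combination of nonassociative words of length at most $d$ in the variables. It is an identity of a left-symmetric algebra $A$ if $g(a_1,\dots,a_m)=0$ for all $a_1,\dots,a_m\in A$, and it is nontrivial if $g\ne 0$ in $LS\langle z_1,\dots,z_m\rangle$. Let $R_y$ denote the operator of right multiplication $a\mapsto ay$. Then $$R_{y_1}R_{y_2}\cdots R_{y_n}z=(\cdots((z\,y_n)\,y_{n-1})\cdots)\,y_1\in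 LS\langle y_1,\dots,y_n,z\rangle$$ is a nontrivial left-symmetric polynomial identity of $ST(\mathscr L_n)$ of degree $n+1$, and this degree is minimal: every nontrivial left-symmetric polynomial identity of $ST(\mathscr L_n)$, in any finite number of variables, has degree at least $n+1$. -/

import Mathlib

noncomputable section

/-! ## Free left-symmetric algebras

Left-symmetric algebras are Mathlib's left pre-Lie algebras (`LeftPreLieRing`,
`LeftPreLieAlgebra`): the associator `(x * y) * z - x * (y * z)` is symmetric in `x`, `y`. -/

namespace FreeLeftSymmetric

/-- The quotient of the free non-associative algebra by the equivalence relation generated by this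
relation is the free left-symmetric algebra. -/
inductive Rel (R X : Type*) [CommRing R] :
    FreeNonUnitalNonAssocAlgebra R X → FreeNonUnitalNonAssocAlgebra R X → Prop
  | left_symm (a b c : FreeNonUnitalNonAssocAlgebra R X) :
      Rel R X (associator a b c) (associator b a c)
  | smul (t : R) {a b : FreeNonUnitalNonAssocAlgebra R X} : Rel R X a b → Rel R X (t • a) (t • b)
  | add_right {a b : FreeNonUnitalNonAssocAlgebra R X} (c : FreeNonUnitalNonAssocAlgebra R X) :
      Rel R X a b → Rel R X (a + c) (b + c)
  | mul_left (a : FreeNonUnitalNonAssocAlgebra R X) {b c : FreeNonUnitalNonAssocAlgebra R X} :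
      Rel R X b c → Rel R X (a * b) (a * c)
  | mul_right {a b : FreeNonUnitalNonAssocAlgebra R X} (c : FreeNonUnitalNonAssocAlgebra R X) :
      Rel R X a b → Rel R X (a * c) (b * c)

variable {R X : Type*} [CommRing R]

theorem Rel.add_left (a : FreeNonUnitalNonAssocAlgebra R X)
    {b c : FreeNonUnitalNonAssocAlgebra R X} (h : Rel R X b c) : Rel R X (a + b) (a + c) := by
  rw [add_comm _ b, add_comm _ c]; exact h.add_right _

theorem Rel.neg {a b : FreeNonUnitalNonAssocAlgebra R X} (h : Rel R X a b) :
    Rel R X (-a) (-b) := by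
  simpa only [neg_one_smul] using h.smul (-1)

theorem Rel.sub_left (a : FreeNonUnitalNonAssocAlgebra R X)
    {b c : FreeNonUnitalNonAssocAlgebra R X} (h : Rel R X b c) : Rel R X (a - b) (a - c) := by
  simpa only [sub_eq_add_neg] using h.neg.add_left a

theorem Rel.sub_right {a b : FreeNonUnitalNonAssocAlgebra R X}
    (c : FreeNonUnitalNonAssocAlgebra R X) (h : Rel R X a b) : Rel R X (a - c) (b - c) := by
  simpa only [sub_eq_add_neg] using h.add_right (-c)

end FreeLeftSymmetric

/-- The free left-symmetric `R`-algebra `LS⟨X⟩` on the set `X` of free generators. -/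
def FreeLeftSymmetric (R X : Type*) [CommRing R] : Type _ :=
  Quot (FreeLeftSymmetric.Rel R X)

namespace FreeLeftSymmetric

variable (R : Type*) {X : Type*} [CommRing R]

instance : SMul R (FreeLeftSymmetric R X) where
  smul t := Quot.map (t • ·) fun _ _ h => Rel.smul t h

instance : SMul ℕ (FreeLeftSymmetric R X) where
  smul t := Quot.map (t • ·) fun a b h => by
    simpa only [Nat.cast_smul_eq_nsmul] using Rel.smul (t : R) h

instance : SMul ℤ (FreeLeftSymmetric R X) where
  smul t := Quot.map (t • ·) fun a b h => by
    simpa only [Int.cast_smul_eq_zsmul] using Rel.smul (t : R) h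

instance : Zero (FreeLeftSymmetric R X) where zero := Quot.mk _ 0

instance : Add (FreeLeftSymmetric R X) where
  add := Quot.map₂ (· + ·) (fun _ _ _ => Rel.add_left _) fun _ _ _ => Rel.add_right _

instance : Neg (FreeLeftSymmetric R X) where neg := Quot.map Neg.neg fun _ _ => Rel.neg

instance : Sub (FreeLeftSymmetric R X) where
  sub := Quot.map₂ Sub.sub (fun _ _ _ => Rel.sub_left _) fun _ _ _ => Rel.sub_right _

instance : Mul (FreeLeftSymmetric R X) where
  mul := Quot.map₂ (· * ·) (fun _ _ _ => Rel.mul_left _) fun _ _ _ => Rel.mul_right _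

instance : NonUnitalNonAssocRing (FreeLeftSymmetric R X) :=
  Function.Surjective.nonUnitalNonAssocRing (Quot.mk (Rel R X)) Quot.mk_surjective rfl
    (fun _ _ => rfl) (fun _ _ => rfl) (fun _ => rfl) (fun _ _ => rfl) (fun _ _ => rfl)
    fun _ _ => rfl

instance : LeftPreLieRing (FreeLeftSymmetric R X) where
  assoc_symm' := by rintro ⟨a⟩ ⟨b⟩ ⟨c⟩; exact Quot.sound (Rel.left_symm a b c)

instance : Module R (FreeLeftSymmetric R X) :=
  Function.Surjective.module R ⟨⟨Quot.mk (Rel R X), rfl⟩, fun _ _ => rfl⟩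
    Quot.mk_surjective (fun _ _ => rfl)

instance : LeftPreLieAlgebra R (FreeLeftSymmetric R X) where
  smul_assoc := by
    rintro t ⟨a⟩ ⟨b⟩
    exact congrArg (Quot.mk (Rel R X)) (smul_mul_assoc t a b)
  smul_comm := by
    rintro t ⟨a⟩ ⟨b⟩
    exact congrArg (Quot.mk (Rel R X)) (mul_smul_comm t a b).symm

/-- The projection from the free non-associative algebra. -/
def mk : FreeNonUnitalNonAssocAlgebra R X →ₙₐ[R] FreeLeftSymmetric R X where
  toFun := Quot.mk (Rel R X)
  map_smul' _ _ := rfl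
  map_zero' := rfl
  map_add' _ _ := rfl
  map_mul' _ _ := rfl

/-- The free generators. -/
def of (x : X) : FreeLeftSymmetric R X := mk R (FreeNonUnitalNonAssocAlgebra.of R x)

/-- The element of the free left-symmetric algebra represented by a nonassociative word. -/
def word (w : FreeMagma X) : FreeLeftSymmetric R X := mk R (MonoidAlgebra.ofMagma R _ w)

section lift

variable {A : Type*} [LeftPreLieRing A] [LeftPreLieAlgebra R A]

theorem lift_aux (a : X → A) {g h : FreeNonUnitalNonAssocAlgebra R X} (r : Rel R X g h) :
    FreeNonUnitalNonAssocAlgebra.lift R a g = FreeNonUnitalNonAssocAlgebra.lift R a h := by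
  induction r with
  | left_symm x y z =>
    simpa only [associator, map_sub, map_mul] using LeftPreLieRing.assoc_symm
      (FreeNonUnitalNonAssocAlgebra.lift R a x) (FreeNonUnitalNonAssocAlgebra.lift R a y)
      (FreeNonUnitalNonAssocAlgebra.lift R a z)
  | smul t _ ih => simp only [map_smul, ih]
  | add_right c _ ih => simp only [map_add, ih]
  | mul_left c _ ih => simp only [map_mul, ih]
  | mul_right c _ ih => simp only [map_mul, ih]

/-- Substitution of elements of a left-symmetric algebra for the free generators. -/
def lift (a : X → A) : FreeLeftSymmetric R X →ₙₐ[R] A where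
  toFun := Quot.lift (FreeNonUnitalNonAssocAlgebra.lift R a) fun _ _ => lift_aux R a
  map_smul' := by rintro t ⟨g⟩; exact map_smul (FreeNonUnitalNonAssocAlgebra.lift R a) t g
  map_zero' := map_zero (FreeNonUnitalNonAssocAlgebra.lift R a)
  map_add' := by rintro ⟨g⟩ ⟨h⟩; exact map_add (FreeNonUnitalNonAssocAlgebra.lift R a) g h
  map_mul' := by rintro ⟨g⟩ ⟨h⟩; exact map_mul (FreeNonUnitalNonAssocAlgebra.lift R a) g h

@[simp]
theorem lift_of (a : X → A) (x : X) : lift R a (of R x) = a x :=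
  FreeNonUnitalNonAssocAlgebra.lift_of_apply R a x

end lift

variable {R}

/-- `g = 0` is a left-symmetric polynomial identity of the left-symmetric algebra `A`: `g` vanishes
under all substitutions of elements of `A` for the variables. -/
def IsIdentityOf (g : FreeLeftSymmetric R X) (A : Type*) [LeftPreLieRing A]
    [LeftPreLieAlgebra R A] : Prop :=
  ∀ a : X → A, lift R a g = 0

variable (R X) in
/-- The space of left-symmetric polynomials of degree at most `d`: the linear combinations of
nonassociative words of length at most `d`. -/
def degreeLE (d : ℕ) : Submodule R (FreeLeftSymmetric R X) :=
  Submodule.span R {g | ∃ w : FreeMagma X, w.length ≤ d ∧ g = word R w}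

/-- The degree of a left-symmetric polynomial (with the convention that the degree of `0` is
`0`). -/
def degree (g : FreeLeftSymmetric R X) : ℕ :=
  sInf {d : ℕ | g ∈ degreeLE R X d}

variable (R) in
/-- The left-symmetric polynomial `R_{y₁} R_{y₂} ⋯ R_{yₙ} z` in the `n + 1` variables
`y₁, …, yₙ, z`, where `R_y` is the operator `a ↦ a * y` and `z` is the last variable. -/
def rightNil (n : ℕ) : FreeLeftSymmetric R (Fin (n + 1)) :=
  (List.ofFn fun i : Fin n => LinearMap.mulRight R (of R i.castSucc)).prod (of R (Fin.last n))

end FreeLeftSymmetric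

/-! ## The left-symmetric Witt algebra and its strongly triangular derivations -/

/-- The underlying space of the left-symmetric Witt algebra of index `n`: all derivations of
`k[x₁, …, xₙ]`. -/
def LSWitt (k : Type*) [Field k] (n : ℕ) : Type _ :=
  Derivation k (MvPolynomial (Fin n) k) (MvPolynomial (Fin n) k)

namespace LSWitt

open MvPolynomial

variable {k : Type*} [Field k] {n : ℕ}

instance : AddCommGroup (LSWitt k n) :=
  inferInstanceAs (AddCommGroup (Derivation k (MvPolynomial (Fin n) k) (MvPolynomial (Fin n) k)))

instance : Module k (LSWitt k n) :=
  inferInstanceAs (Module k (Derivation k (MvPolynomial (Fin n) k) (MvPolynomial (Fin n) k)))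

/-- An element of the Witt algebra as a derivation. -/
def toDer (D : LSWitt k n) : Derivation k (MvPolynomial (Fin n) k) (MvPolynomial (Fin n) k) := D

/-- The coefficient of `∂ⱼ` in `D`, i.e. `D xⱼ`. -/
def coeff (D : LSWitt k n) (j : Fin n) : MvPolynomial (Fin n) k := D.toDer (X j)

/-- The derivation `f₁ ∂₁ + ⋯ + fₙ ∂ₙ`. -/
def ofCoeff (f : Fin n → MvPolynomial (Fin n) k) : LSWitt k n := mkDerivation k f

/-- The derivation `f ∂ᵢ`. -/
def single (f : MvPolynomial (Fin n) k) (i : Fin n) : LSWitt k n :=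
  (f • pderiv i : Derivation k (MvPolynomial (Fin n) k) (MvPolynomial (Fin n) k))

@[ext]
theorem ext {D E : LSWitt k n} (h : ∀ j, D.coeff j = E.coeff j) : D = E :=
  MvPolynomial.derivation_ext h

@[simp] theorem coeff_ofCoeff (f : Fin n → MvPolynomial (Fin n) k) (j : Fin n) :
    (ofCoeff f).coeff j = f j := mkDerivation_X _ _ _

@[simp] theorem coeff_zero (j : Fin n) : (0 : LSWitt k n).coeff j = 0 := rfl

@[simp] theorem coeff_add (D E : LSWitt k n) (j : Fin n) :
    (D + E).coeff j = D.coeff j + E.coeff j := rfl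

@[simp] theorem coeff_smul (c : k) (D : LSWitt k n) (j : Fin n) :
    (c • D).coeff j = c • D.coeff j := rfl

@[simp] theorem coeff_single (f : MvPolynomial (Fin n) k) (i j : Fin n) :
    (single f i).coeff j = f * Pi.single (M := fun _ => MvPolynomial (Fin n) k) i 1 j :=
  congrArg (f * ·) (pderiv_X i j)

@[simp] theorem toDer_add (D E : LSWitt k n) (f : MvPolynomial (Fin n) k) :
    (D + E).toDer f = D.toDer f + E.toDer f := rfl

@[simp] theorem toDer_smul (c : k) (D : LSWitt k n) (f : MvPolynomial (Fin n) k) :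
    (c • D).toDer f = c • D.toDer f := rfl

@[simp] theorem toDer_single (f : MvPolynomial (Fin n) k) (i : Fin n)
    (g : MvPolynomial (Fin n) k) : (single f i).toDer g = f * pderiv i g := rfl

/-- The product `D · (f₁ ∂₁ + ⋯ + fₙ ∂ₙ) = D(f₁) ∂₁ + ⋯ + D(fₙ) ∂ₙ`. -/
instance : Mul (LSWitt k n) where
  mul D E := ofCoeff fun j => D.toDer (E.coeff j)

@[simp] theorem coeff_mul (D E : LSWitt k n) (j : Fin n) :
    (D * E).coeff j = D.toDer (E.coeff j) := coeff_ofCoeff _ _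

/-- The defining formula `a ∂ᵢ · b ∂ⱼ = (a ∂ᵢ(b)) ∂ⱼ`. -/
theorem single_mul_single (a b : MvPolynomial (Fin n) k) (i j : Fin n) :
    single a i * single b j = single (a * pderiv i b) j := by
  ext l : 1
  by_cases h : l = j
  · subst h; simp
  · simp [Pi.single_eq_of_ne h]

instance : NonUnitalNonAssocRing (LSWitt k n) :=
  { (inferInstance : AddCommGroup (LSWitt k n)), (inferInstance : Mul (LSWitt k n)) with
    left_distrib := fun D E F => by ext j : 1; simp
    right_distrib := fun D E F => by ext j : 1; simp
    zero_mul := fun D => by ext j : 1; rw [coeff_mul]; rfl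
    mul_zero := fun D => by ext j : 1; simp }

/-- The left-symmetric identity holds. -/
instance : LeftPreLieRing (LSWitt k n) where
  assoc_symm' D E F := by
    have h : ∀ j, ⁅D.toDer, E.toDer⁆ (F.coeff j) = (D * E - E * D).toDer (F.coeff j) := by
      intro j
      refine congrFun (congrArg DFunLike.coe ?_) (F.coeff j)
      refine MvPolynomial.derivation_ext fun l => ?_
      rw [Derivation.commutator_apply]
      change _ = (D * E).coeff l - (E * D).coeff l
      rw [coeff_mul, coeff_mul]; rfl
    ext j : 1
    have hj := h j
    rw [Derivation.commutator_apply] at hj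
    change _ = (D * E).toDer _ - (E * D).toDer _ at hj
    change ((D * E) * F).coeff j - (D * (E * F)).coeff j
      = ((E * D) * F).coeff j - (E * (D * F)).coeff j
    simp only [coeff_mul]
    linear_combination -hj

instance : LeftPreLieAlgebra k (LSWitt k n) where
  smul_assoc c D E := by
    ext j : 1
    change ((c • D) * E).coeff j = (c • (D * E)).coeff j
    simp
  smul_comm c D E := by
    ext j : 1
    change (c • (D * E)).coeff j = (D * (c • E)).coeff j
    simp

/-- The generators `x_{i+1}^{s_{i+1}} ⋯ x_n^{s_n} ∂ᵢ` of the space of strongly triangular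
derivations. -/
def stGenerators (k : Type*) [Field k] (n : ℕ) : Set (LSWitt k n) :=
  {D | ∃ (i : Fin n) (s : Fin n →₀ ℕ), (∀ j, s j ≠ 0 → i < j) ∧ D = single (monomial s 1) i}

theorem stGenerators_mul {D E : LSWitt k n} (hD : D ∈ stGenerators k n)
    (hE : E ∈ stGenerators k n) : D * E ∈ Submodule.span k (stGenerators k n) := by
  obtain ⟨i, s, hs, rfl⟩ := hD
  obtain ⟨j, t, ht, rfl⟩ := hE
  rw [single_mul_single, pderiv_monomial, monomial_mul]
  by_cases hti : t i = 0
  · have : single (0 : MvPolynomial (Fin n) k) j = 0 := by ext l : 1; simp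
    simp [hti, this]
  have hc : single (monomial (s + (t - Finsupp.single i 1)) ((1 : k) * (1 * (t i : k)))) j
      = (t i : k) • single (monomial (s + (t - Finsupp.single i 1)) (1 : k)) j := by
    ext l : 1
    rw [coeff_smul, coeff_single, coeff_single, ← smul_mul_assoc, smul_monomial]
    simp
  rw [hc]
  refine Submodule.smul_mem _ _ (Submodule.subset_span ⟨j, _, fun l hl => ?_, rfl⟩)
  by_cases hsl : s l = 0
  · refine ht l fun h0 => hl ?_
    simp [hsl, h0]
  · exact (ht i hti).trans (hs l hsl)

end LSWitt

open LSWitt in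
/-- The algebra `ST(𝓛ₙ)` of strongly triangular derivations: the subspace of the left-symmetric
Witt algebra spanned by the derivations `x_{i+1}^{s_{i+1}} ⋯ x_n^{s_n} ∂ᵢ`; it is a
subalgebra. -/
def StronglyTriangular (k : Type*) [Field k] (n : ℕ) : NonUnitalSubalgebra k (LSWitt k n) where
  __ := Submodule.span k (stGenerators k n)
  mul_mem' {D E} hD hE := by
    change D ∈ Submodule.span k (stGenerators k n) at hD
    change E ∈ Submodule.span k (stGenerators k n) at hE
    change D * E ∈ Submodule.span k (stGenerators k n)
    induction hD, hE using Submodule.span_induction₂ with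
    | mem_mem x y hx hy => exact stGenerators_mul hx hy
    | zero_left y hy => rw [zero_mul]; exact zero_mem _
    | zero_right x hx => rw [mul_zero]; exact zero_mem _
    | add_left x y z _ _ _ h₁ h₂ => rw [add_mul]; exact add_mem h₁ h₂
    | add_right x y z _ _ _ h₁ h₂ => rw [mul_add]; exact add_mem h₁ h₂
    | smul_left r x y _ _ h => rw [smul_mul_assoc]; exact Submodule.smul_mem _ _ h
    | smul_right r x y _ _ h => rw [mul_smul_comm]; exact Submodule.smul_mem _ _ h

instance (k : Type*) [Field k] (n : ℕ) : LeftPreLieRing (StronglyTriangular k n) where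
  assoc_symm' D E F :=
    Subtype.ext (LeftPreLieRing.assoc_symm (D : LSWitt k n) (E : LSWitt k n) (F : LSWitt k n))

instance (k : Type*) [Field k] (n : ℕ) : LeftPreLieAlgebra k (StronglyTriangular k n) where
  smul_assoc c D E := smul_assoc c D E
  smul_comm c D E := smul_comm c D E

end

/-!
By induction on the number of right factors, a product `(⋯ (z * yₙ) ⋯) * yᵢ` of strongly triangular
derivations has no component along `∂ᵢ, …, ∂ₙ`, because the coefficient of `∂ⱼ` in a strongly
triangular derivation only involves the variables after `xⱼ`. Hence `rightNil k n` is an identity.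
It is nonzero since it does not vanish on the idempotent `x ∂` of the Witt algebra of index one.

That no identity has smaller degree rests on the description of the free left-symmetric algebra by
rooted trees. The algebra is generated by the variables as a free module over itself under left
multiplications (`exists_equivariant`); applied to the commutator action on endomorphisms, this
yields a second product `graft`, the attachment of one tree to the root of another, for which left
multiplications are derivations and which satisfies `a ∘ (b ∘ v) = b ∘ (a ∘ v)`. The monomials in
`graft` with `d` letters are the trees with `d` vertices, and they span the same filtration as the
nonassociative words (`degreeLE_le_span_tree`).

The trees with at most `n` vertices are separated by substitutions of strongly triangular
derivations. Given such a tree, number its vertices increasingly away from the root and substitute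
for a letter the sum of the derivations `(∏ xⱼ) ∂ᵢ` over the vertices `i` with that label, where `j`
runs over the children of `i`. The value of another tree at the origin, in the coordinate of the
root, is the number of isomorphisms between the two trees (`constantCoeff_symbol_tree`). In
characteristic zero it is nonzero exactly when the two trees agree, so a linear combination of trees
with at most `n` vertices that is an identity is zero (`eq_zero_of_mem_degreeLE`).
-/

noncomputable section

/-! ### Words and homomorphisms -/

namespace FreeLeftSymmetric

variable {R X : Type*} [CommRing R]

theorem word_of (x : X) : word R (FreeMagma.of x) = of R x := rfl

theorem word_mul (v w : FreeMagma X) : word R (v * w) = word R v * word R w := by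
  simp only [word, map_mul]

theorem span_range_word : Submodule.span R (Set.range (word R : FreeMagma X → _)) = ⊤ := by
  refine eq_top_iff.2 fun g _ => ?_
  obtain ⟨p, rfl⟩ : ∃ p, mk R p = g := Quot.exists_rep g
  induction p using MonoidAlgebra.induction_linear with
  | zero => rw [map_zero]; exact zero_mem _
  | add p q hp hq => rw [map_add]; exact add_mem (hp trivial) (hq trivial)
  | single w t =>
    have : MonoidAlgebra.single w t = t • MonoidAlgebra.ofMagma R _ w := by
      simp [MonoidAlgebra.ofMagma]
    rw [this, map_smul]
    exact Submodule.smul_mem _ _ (Submodule.subset_span ⟨w, rfl⟩)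

/-- A property that holds for the generators and is preserved by linear combinations holds
everywhere as soon as it passes from the factors to a product. -/
theorem induction {p : FreeLeftSymmetric R X → Prop} (zero : p 0)
    (add : ∀ u v, p u → p v → p (u + v)) (smul : ∀ (t : R) u, p u → p (t • u))
    (gen : ∀ x, p (of R x)) (mul : ∀ u v, p u → p v → p (u * v)) (g : FreeLeftSymmetric R X) :
    p g := by
  have hg : g ∈ Submodule.span R (Set.range (word R : FreeMagma X → _)) := by
    rw [span_range_word]; trivial
  induction hg using Submodule.span_induction with
  | mem _ h =>
    obtain ⟨w, rfl⟩ := h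
    induction w using FreeMagma.recOnMul with
    | ih1 x => exact gen x
    | ih2 v w hv hw => rw [word_mul]; exact mul _ _ hv hw
  | zero => exact zero
  | add u v _ _ hu hv => exact add u v hu hv
  | smul t u _ hu => exact smul t u hu

/-- An action `ρ` of a left-symmetric algebra `A` on a module `M` satisfying
`[ρ u, ρ v] = ρ (u * v - v * u)`. This is a representation of the commutator Lie algebra of `A`. -/
structure Action (R A M : Type*) [CommRing R] [LeftPreLieRing A] [LeftPreLieAlgebra R A]
    [AddCommGroup M] [Module R M] where
  /-- The representing endomorphisms. -/
  toLin : A →ₗ[R] M →ₗ[R] M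
  comm : ∀ u v m, toLin (u * v) m - toLin u (toLin v m) = toLin (v * u) m - toLin v (toLin u m)

namespace Action

variable {A M : Type*} [LeftPreLieRing A] [LeftPreLieAlgebra R A] [AddCommGroup M] [Module R M]

/-- The split extension of `A` by `M`: the module `A × M` with the product
`(u, m) * (v, m') = (u * v, ρ u m')`. The right action of `A` on `M` is zero. -/
def Ext (_ρ : Action R A M) : Type _ := A × M

variable (ρ : Action R A M)

instance : AddCommGroup ρ.Ext := inferInstanceAs (AddCommGroup (A × M))

instance : Module R ρ.Ext := inferInstanceAs (Module R (A × M))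

instance : Mul ρ.Ext where
  mul p q := (p.1 * q.1, ρ.toLin p.1 q.2)

theorem ext_mul (p q : ρ.Ext) : p * q = ((p.1 * q.1, ρ.toLin p.1 q.2) : A × M) := rfl

instance : NonUnitalNonAssocRing ρ.Ext :=
  { (inferInstance : AddCommGroup ρ.Ext), (inferInstance : Mul ρ.Ext) with
    left_distrib := fun p q r => Prod.ext (mul_add p.1 q.1 r.1) (map_add (ρ.toLin p.1) q.2 r.2)
    right_distrib := fun p q r => Prod.ext (add_mul p.1 q.1 r.1)
      (LinearMap.congr_fun (map_add ρ.toLin p.1 q.1) r.2)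
    zero_mul := fun p => Prod.ext (zero_mul p.1) (LinearMap.congr_fun (map_zero ρ.toLin) p.2)
    mul_zero := fun p => Prod.ext (mul_zero p.1) (map_zero (ρ.toLin p.1)) }

instance : LeftPreLieRing ρ.Ext where
  assoc_symm' p q r := Prod.ext (LeftPreLieRing.assoc_symm p.1 q.1 r.1) (ρ.comm p.1 q.1 r.2)

instance : LeftPreLieAlgebra R ρ.Ext where
  smul_assoc t p q := Prod.ext (smul_mul_assoc t p.1 q.1)
    (LinearMap.congr_fun (map_smul ρ.toLin t p.1) q.2)
  smul_comm t p q := Prod.ext (mul_smul_comm t p.1 q.1).symm (map_smul (ρ.toLin p.1) t q.2).symm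

end Action

variable {M : Type*} [AddCommGroup M] [Module R M]

/-- The free left-symmetric algebra is, as a module over itself under left multiplications, freely
generated by the variables: any assignment `m` of elements of `M` to the variables extends to an
equivariant linear map. -/
theorem exists_equivariant (ρ : Action R (FreeLeftSymmetric R X) M) (m : X → M) :
    ∃ Φ : FreeLeftSymmetric R X →ₗ[R] M, (∀ x, Φ (of R x) = m x) ∧
      ∀ u v, Φ (u * v) = ρ.toLin u (Φ v) := by
  let ψ : FreeLeftSymmetric R X →ₙₐ[R] ρ.Ext := lift R fun x => ((of R x, m x) : _ × M)
  have hψ : ∀ x, ψ (of R x) = ((of R x, m x) : _ × M) := fun x => lift_of R _ x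
  have fst : ∀ g, (ψ g).1 = g := by
    refine induction ?_ (fun u v hu hv => ?_) (fun t u hu => ?_) (fun x => ?_) fun u v hu hv => ?_
    · rw [map_zero]; rfl
    · rw [map_add]; exact congrArg₂ (· + ·) hu hv
    · rw [map_smul]; exact congrArg (t • ·) hu
    · rw [hψ]
    · rw [map_mul]; exact congrArg₂ (· * ·) hu hv
  refine ⟨(LinearMap.snd R _ M).comp (show _ →ₗ[R] _ × M from (ψ : _ →ₗ[R] ρ.Ext)),
    fun x => ?_, fun u v => ?_⟩
  · exact congrArg Prod.snd (hψ x)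
  · change (ψ (u * v)).2 = ρ.toLin u (ψ v).2
    rw [map_mul, Action.ext_mul, fst]

/-! ### Grafting at the root -/

/-- The commutator action `u ↦ [L_u, ·]` on the linear endomorphisms, `L_u` being the left
multiplication by `u`. -/
def commutatorAction (A : Type*) [LeftPreLieRing A] [LeftPreLieAlgebra R A] :
    Action R A (Module.End R A) where
  toLin := (LinearMap.mul R (Module.End R A) - (LinearMap.mul R (Module.End R A)).flip) ∘ₗ
    LinearMap.mul R A
  comm u v m := by
    ext y
    have h₁ := LeftPreLieRing.assoc_symm u v (m y)
    have h₂ := congrArg m (LeftPreLieRing.assoc_symm u v y)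
    simp only [associator, map_sub] at h₁ h₂
    simp only [LinearMap.comp_apply, LinearMap.sub_apply, LinearMap.flip_apply,
      LinearMap.mul_apply', Module.End.mul_apply, map_sub]
    linear_combination (norm := abel) h₁ - h₂

theorem exists_graft : ∃ Φ : FreeLeftSymmetric R X →ₗ[R] Module.End R (FreeLeftSymmetric R X),
    (∀ x a, Φ (of R x) a = a * of R x) ∧
      ∀ u v a, Φ (u * v) a = u * Φ v a - Φ v (u * a) := by
  obtain ⟨Φ, h₁, h₂⟩ := exists_equivariant (commutatorAction (FreeLeftSymmetric R X))
    fun x : X => LinearMap.mulRight R (of R x)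
  exact ⟨Φ, fun x a => by rw [h₁]; rfl, fun u v a => by rw [h₂]; rfl⟩

/-- The root grafting product: on rooted trees, `graft a v` attaches the root of `a` to the root
of `v` by a new edge, whereas `a * v` is the sum over all vertices of `v` of the trees in which the
root of `a` is attached to that vertex. Since left multiplications are derivations of root grafting,
it is determined recursively by `mul_graft` and `graft_of`. -/
def graft : FreeLeftSymmetric R X →ₗ[R] Module.End R (FreeLeftSymmetric R X) :=
  exists_graft.choose.flip

theorem graft_of (a : FreeLeftSymmetric R X) (x : X) : graft a (of R x) = a * of R x :=
  exists_graft.choose_spec.1 x a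

theorem graft_mul (a u v : FreeLeftSymmetric R X) :
    graft a (u * v) = u * graft a v - graft (u * a) v :=
  exists_graft.choose_spec.2 u v a

theorem mul_graft (u a v : FreeLeftSymmetric R X) :
    u * graft a v = graft (u * a) v + graft a (u * v) := by
  rw [graft_mul]; abel

theorem graft_left_comm (a b v : FreeLeftSymmetric R X) :
    graft a (graft b v) = graft b (graft a v) := by
  revert a b
  induction v using induction with
  | zero => simp
  | add u v hu hv => intro a b; simp only [map_add, hu a b, hv a b]
  | smul t u hu => intro a b; simp only [map_smul, hu a b]
  | gen x =>
    intro a b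
    have h := LeftPreLieRing.assoc_symm a b (of R x)
    simp only [associator] at h
    rw [graft_of, graft_of, graft_mul, graft_mul, graft_of, graft_of, graft_of, graft_of]
    linear_combination (norm := abel) h
  | mul u v _ hv =>
    intro a b
    rw [graft_mul b u v, graft_mul a u v, map_sub, map_sub, graft_mul, graft_mul, hv a b,
      hv (u * a) b, hv a (u * b)]
    abel

/-- The rooted tree encoded by a nonassociative word: a letter is a single vertex, and the tree of
`v * w` is the tree of `w` with the tree of `v` attached to its root. The vertices of the tree are
the letters of the word. -/
def tree : FreeMagma X → FreeLeftSymmetric R X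
  | .of x => of R x
  | .mul v w => graft (tree v) (tree w)

theorem tree_mul (v w : FreeMagma X) : tree (R := R) (v * w) = graft (tree v) (tree w) := rfl

variable (R X) in
/-- The span of the trees with `d` vertices. -/
def treeSpan (d : ℕ) : Submodule R (FreeLeftSymmetric R X) :=
  Submodule.span R {g | ∃ w : FreeMagma X, w.length = d ∧ g = tree w}

theorem tree_mem_treeSpan (w : FreeMagma X) : tree w ∈ treeSpan R X w.length :=
  Submodule.subset_span ⟨w, rfl, rfl⟩

/-- A bilinear operation of degree zero on trees is one on their spans. -/
theorem map₂_mem_treeSpan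
    (B : FreeLeftSymmetric R X →ₗ[R] FreeLeftSymmetric R X →ₗ[R] FreeLeftSymmetric R X) {c d e : ℕ}
    (h : ∀ v w : FreeMagma X, v.length = c → w.length = d → B (tree v) (tree w) ∈ treeSpan R X e)
    {u v : FreeLeftSymmetric R X} (hu : u ∈ treeSpan R X c) (hv : v ∈ treeSpan R X d) :
    B u v ∈ treeSpan R X e := by
  induction hu, hv using Submodule.span_induction₂ with
  | mem_mem u v hu hv =>
    obtain ⟨u, hu, rfl⟩ := hu
    obtain ⟨v, hv, rfl⟩ := hv
    exact h u v hu hv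
  | zero_left => simp
  | zero_right => simp
  | add_left u v z _ _ _ h₁ h₂ => rw [map_add]; exact add_mem h₁ h₂
  | add_right u v z _ _ _ h₁ h₂ => rw [map_add]; exact add_mem h₁ h₂
  | smul_left t u v _ _ h => rw [map_smul]; exact Submodule.smul_mem _ _ h
  | smul_right t u v _ _ h => rw [map_smul]; exact Submodule.smul_mem _ _ h

theorem graft_mem_treeSpan {u v : FreeLeftSymmetric R X} {c d : ℕ} (hu : u ∈ treeSpan R X c)
    (hv : v ∈ treeSpan R X d) : graft u v ∈ treeSpan R X (c + d) :=
  map₂_mem_treeSpan graft (by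
    rintro v w rfl rfl
    exact tree_mem_treeSpan (v * w)) hu hv

theorem tree_mul_tree_mem_treeSpan (v w : FreeMagma X) :
    tree (R := R) v * tree w ∈ treeSpan R X (v.length + w.length) := by
  induction w using FreeMagma.recOnMul with
  | ih1 x =>
    rw [show tree (R := R) (FreeMagma.of x) = of R x from rfl, ← graft_of]
    exact tree_mem_treeSpan (v * FreeMagma.of x)
  | ih2 a b ha hb =>
    rw [tree_mul, mul_graft]
    change _ ∈ treeSpan R X (v.length + (a.length + b.length))
    refine add_mem ?_ ?_
    · rw [← add_assoc]
      exact graft_mem_treeSpan ha (tree_mem_treeSpan b)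
    · rw [add_left_comm]
      exact graft_mem_treeSpan (tree_mem_treeSpan a) hb

theorem word_mem_treeSpan (w : FreeMagma X) : word R w ∈ treeSpan R X w.length := by
  induction w using FreeMagma.recOnMul with
  | ih1 x => exact tree_mem_treeSpan (FreeMagma.of x)
  | ih2 v w hv hw =>
    rw [word_mul]
    refine map₂_mem_treeSpan (LinearMap.mul R _) ?_ hv hw
    rintro a b ha hb
    change _ ∈ treeSpan R X (v.length + w.length)
    rw [← ha, ← hb]
    exact tree_mul_tree_mem_treeSpan a b

theorem degreeLE_le_span_tree (d : ℕ) : degreeLE R X d ≤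
    Submodule.span R ((tree (R := R)) '' {w : FreeMagma X | w.length ≤ d}) := by
  refine Submodule.span_le.2 ?_
  rintro _ ⟨w, hw, rfl⟩
  refine Submodule.span_mono ?_ (word_mem_treeSpan w)
  rintro _ ⟨v, hv, rfl⟩
  exact ⟨v, hv.trans_le hw, rfl⟩

end FreeLeftSymmetric

/-! ### Derivations in coordinates -/

namespace LSWitt

open MvPolynomial

variable {k : Type*} [Field k] {n : ℕ}

theorem toDer_apply (D : LSWitt k n) (f : MvPolynomial (Fin n) k) :
    D.toDer f = ∑ i, D.coeff i * pderiv i f := by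
  have sum_apply : ∀ g, (∑ i, D.coeff i • pderiv i : Derivation k _ _) g
      = ∑ i, D.coeff i * pderiv i g := fun g => by
    have := congrFun (map_sum (Derivation.coeFnAddMonoidHom (R := k)
      (A := MvPolynomial (Fin n) k) (M := MvPolynomial (Fin n) k))
      (fun i => D.coeff i • pderiv i) Finset.univ) g
    rw [Finset.sum_apply] at this
    exact this
  have h : D.toDer = ∑ i, D.coeff i • pderiv i := by
    refine MvPolynomial.derivation_ext fun j => ?_
    rw [sum_apply, Finset.sum_eq_single j]
    · simp [coeff]
    · intro i _ hij
      simp [pderiv_X_of_ne hij.symm]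
    · simp
  rw [h, sum_apply]

end LSWitt

namespace FreeLeftSymmetric

open MvPolynomial LSWitt

variable {k X : Type*} [Field k] {n : ℕ}

/-- The natural action of derivations on polynomials, restricted to the free left-symmetric algebra
along a homomorphism. -/
def derAction (φ : FreeLeftSymmetric k X →ₙₐ[k] LSWitt k n) :
    Action k (FreeLeftSymmetric k X) (MvPolynomial (Fin n) k) where
  toLin :=
    { toFun := fun u => ((φ u).toDer : _ →ₗ[k] _)
      map_add' := fun u v => by rw [map_add]; rfl
      map_smul' := fun t u => by rw [map_smul]; rfl }
  comm u v f := by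
    change (φ (u * v)).toDer f - (φ u).toDer ((φ v).toDer f)
      = (φ (v * u)).toDer f - (φ v).toDer ((φ u).toDer f)
    have key : ⁅(φ u).toDer, (φ v).toDer⁆ = (φ (u * v)).toDer - (φ (v * u)).toDer := by
      refine MvPolynomial.derivation_ext fun l => ?_
      rw [Derivation.commutator_apply, map_mul, map_mul]
      change _ = (φ u * φ v).coeff l - (φ v * φ u).coeff l
      rw [LSWitt.coeff_mul, LSWitt.coeff_mul]; rfl
    have := congrArg (fun D => D f) key
    simp only [Derivation.commutator_apply, Derivation.sub_apply] at this
    linear_combination -this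

theorem exists_symbol (φ : FreeLeftSymmetric k X →ₙₐ[k] LSWitt k n)
    (f : X → MvPolynomial (Fin n) k) :
    ∃ Φ : FreeLeftSymmetric k X →ₗ[k] MvPolynomial (Fin n) k, (∀ x, Φ (of k x) = f x) ∧
      ∀ u v, Φ (u * v) = (φ u).toDer (Φ v) :=
  exists_equivariant (derAction φ) f

/-- The linear map that sends a tree to the elementary differential in which each nonroot vertex
labelled `x` contributes the derivation `φ x` and a root labelled `x` contributes the polynomial
`f x`. -/
def symbol (φ : FreeLeftSymmetric k X →ₙₐ[k] LSWitt k n) (f : X → MvPolynomial (Fin n) k) :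
    FreeLeftSymmetric k X →ₗ[k] MvPolynomial (Fin n) k :=
  (exists_symbol φ f).choose

variable (φ : FreeLeftSymmetric k X →ₙₐ[k] LSWitt k n) (f : X → MvPolynomial (Fin n) k)

theorem symbol_of (x : X) : symbol φ f (of k x) = f x := (exists_symbol φ f).choose_spec.1 x

theorem symbol_mul (u v : FreeLeftSymmetric k X) :
    symbol φ f (u * v) = (φ u).toDer (symbol φ f v) := (exists_symbol φ f).choose_spec.2 u v

theorem symbol_coeff (i : Fin n) (v : FreeLeftSymmetric k X) :
    symbol φ (fun x => (φ (of k x)).coeff i) v = (φ v).coeff i := by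
  induction v using induction with
  | zero => rw [map_zero, map_zero, LSWitt.coeff_zero]
  | add u v hu hv => rw [map_add, map_add, LSWitt.coeff_add, hu, hv]
  | smul t u hu => rw [map_smul, map_smul, LSWitt.coeff_smul, hu]
  | gen x => rw [symbol_of]
  | mul u v _ hv => rw [symbol_mul, map_mul, LSWitt.coeff_mul, hv]

theorem symbol_zero (v : FreeLeftSymmetric k X) :
    symbol φ (fun _ => (0 : MvPolynomial (Fin n) k)) v = 0 := by
  induction v using induction with
  | zero => rw [map_zero]
  | add u v hu hv => rw [map_add, hu, hv, add_zero]
  | smul t u hu => rw [map_smul, hu, smul_zero]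
  | gen x => rw [symbol_of]
  | mul u v _ hv => rw [symbol_mul, hv, map_zero]

/-- Attaching a tree to the root of `v` differentiates the polynomial at the root of `v` once. -/
theorem symbol_graft (a v : FreeLeftSymmetric k X) :
    symbol φ f (graft a v) =
      ∑ i, (φ a).coeff i * symbol φ (fun x => pderiv i (f x)) v := by
  revert a
  induction v using induction with
  | zero => simp
  | add u v hu hv =>
    intro a
    simp only [map_add, hu a, hv a, mul_add, Finset.sum_add_distrib]
  | smul t u hu =>
    intro a
    simp only [map_smul, hu a, mul_smul_comm, Finset.smul_sum]
  | gen x =>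
    intro a
    simp only [graft_of, symbol_mul, symbol_of, toDer_apply]
  | mul u v _ hv =>
    intro a
    rw [graft_mul, map_sub, symbol_mul, hv, hv, map_sum, ← Finset.sum_sub_distrib]
    refine Finset.sum_congr rfl fun i _ => ?_
    rw [map_mul φ, LSWitt.coeff_mul, symbol_mul, Derivation.leibniz, smul_eq_mul, smul_eq_mul]
    ring

end FreeLeftSymmetric

/-! ### Trees folded along acyclic digraphs -/

/-- A digraph on `{0, …, n - 1}` whose edges go from smaller to larger vertices, with vertices
labelled by `X`. -/
structure LabelledDigraph (n : ℕ) (X : Type*) where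
  /-- The label of a vertex. -/
  label : Fin n → X
  /-- The set of heads of the edges that start at a vertex. -/
  succ : Fin n → Finset (Fin n)
  lt_of_mem : ∀ i, ∀ j ∈ succ i, i < j

namespace LabelledDigraph

open FreeLeftSymmetric

variable {n : ℕ} {X : Type*}

open scoped Classical in
/-- The number of label-preserving maps from the tree of `w` to the digraph `G`, extended by a new
vertex with label `y` and set of successors `K`, that send the root to the new vertex and restrict,
at each vertex of the tree, to a bijection from its children to the successors of its image. -/
def coverings (G : LabelledDigraph n X) : FreeMagma X → X → Finset (Fin n) → ℕ
  | .of x, y, K => if x = y ∧ K = ∅ then 1 else 0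
  | .mul v w, y, K =>
    ∑ i ∈ K, G.coverings v (G.label i) (G.succ i) * G.coverings w y (K.erase i)

variable (G : LabelledDigraph n X)

theorem coverings_of (x y : X) (K : Finset (Fin n)) :
    G.coverings (.of x) y K ≠ 0 ↔ x = y ∧ K = ∅ := by
  simp [coverings]

theorem coverings_mul (v w : FreeMagma X) (y : X) (K : Finset (Fin n)) :
    G.coverings (v * w) y K ≠ 0 ↔ ∃ i ∈ K, G.coverings v (G.label i) (G.succ i) ≠ 0 ∧
      G.coverings w y (K.erase i) ≠ 0 := by
  change ∑ i ∈ K, G.coverings v (G.label i) (G.succ i) * G.coverings w y (K.erase i) ≠ 0 ↔ _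
  simp [Finset.sum_eq_zero_iff]

/-- If the tree of `w` covers `G` from a root with successors `K`, then the branch over any `j ∈ K`
can be split off. -/
theorem exists_branch (R : Type*) [CommRing R] (w : FreeMagma X) (y : X) (K : Finset (Fin n))
    (h : G.coverings w y K ≠ 0) (j : Fin n) (hj : j ∈ K) :
    ∃ a b : FreeMagma X, a.length + b.length = w.length ∧
      G.coverings a (G.label j) (G.succ j) ≠ 0 ∧ G.coverings b y (K.erase j) ≠ 0 ∧
      tree (R := R) w = graft (tree a) (tree b) := by
  induction w using FreeMagma.recOnMul generalizing K with
  | ih1 x =>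
    rw [((G.coverings_of x y K).1 h).2] at hj
    simp at hj
  | ih2 v w _ hw =>
    obtain ⟨i, hi, hv₁, hw₁⟩ := (G.coverings_mul v w y K).1 h
    rcases eq_or_ne j i with rfl | hij
    · exact ⟨v, w, rfl, hv₁, hw₁, rfl⟩
    obtain ⟨a, b, hl, ha, hb, hab⟩ := hw _ hw₁ (Finset.mem_erase.2 ⟨hij, hj⟩)
    refine ⟨a, v * b, ?_, ha, ?_, ?_⟩
    · change a.length + (v.length + b.length) = v.length + w.length
      omega
    · refine (G.coverings_mul v b y _).2 ⟨i, Finset.mem_erase.2 ⟨hij.symm, hi⟩, hv₁, ?_⟩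
      rwa [Finset.erase_right_comm]
    · rw [tree_mul, hab, graft_left_comm, tree_mul]

/-- A tree covering `G` from a given root is the unfolding of `G` at that root; hence it is
determined by `G` and the root. -/
theorem tree_eq_tree (R : Type*) [CommRing R] (v w : FreeMagma X) (y : X) (K : Finset (Fin n))
    (hv : G.coverings v y K ≠ 0) (hw : G.coverings w y K ≠ 0) :
    tree (R := R) v = tree w := by
  induction hd : v.length using Nat.strong_induction_on generalizing v w y K with
  | _ d ih =>
    subst hd
    cases w with
    | of x =>
      obtain ⟨rfl, rfl⟩ := (G.coverings_of x y K).1 hw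
      cases v with
      | of z => rw [((G.coverings_of z x ∅).1 hv).1]
      | mul a b =>
        obtain ⟨i, hi, -⟩ := (G.coverings_mul a b x ∅).1 hv
        simp at hi
    | mul a b =>
      obtain ⟨j, hj, ha, hb⟩ := (G.coverings_mul a b y K).1 hw
      obtain ⟨a', b', hl, ha', hb', h⟩ := G.exists_branch R v y K hv j hj
      have := a'.length_pos
      have := b'.length_pos
      rw [h, ih a'.length (by omega) a' a _ _ ha' ha rfl,
        ih b'.length (by omega) b' b _ _ hb' hb rfl]
      rfl

theorem coverings_congr {G H : LabelledDigraph n X} {s : ℕ}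
    (h : ∀ i : Fin n, s ≤ i → G.label i = H.label i ∧ G.succ i = H.succ i) (w : FreeMagma X) (y : X)
    (K : Finset (Fin n)) (hK : ∀ i ∈ K, s ≤ (i : ℕ)) : G.coverings w y K = H.coverings w y K := by
  induction w using FreeMagma.recOnMul generalizing y K with
  | ih1 x => rfl
  | ih2 v w hv hw =>
    refine Finset.sum_congr rfl fun i hi => ?_
    have hs := hK i hi
    rw [(h i hs).1, (h i hs).2, hw y _ fun j hj => hK j (Finset.mem_of_mem_erase hj), hv]
    intro j hj
    have := H.lt_of_mem i j hj
    omega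

/-- The label of the root of the tree of a word: the last letter. -/
def rootLabel : FreeMagma X → X
  | .of x => x
  | .mul _ w => rootLabel w

/-- Replaces the label and the successors of a single vertex. -/
def update (p : Fin n) (y : X) (K : Finset (Fin n)) (hK : ∀ j ∈ K, p < j) :
    LabelledDigraph n X where
  label := Function.update G.label p y
  succ := Function.update G.succ p K
  lt_of_mem i j hj := by
    rcases eq_or_ne i p with rfl | hi
    · rw [Function.update_self] at hj
      exact hK j hj
    · rw [Function.update_of_ne hi] at hj
      exact G.lt_of_mem i j hj

/-- The nonroot vertices of the tree of `w` can be placed on the last vertices below `s`, leaving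
`G` unchanged from `s` on. -/
theorem exists_coverings_ne_zero (w : FreeMagma X) (G : LabelledDigraph n X) (s : ℕ) (hsn : s ≤ n)
    (hs : w.length ≤ s + 1) :
    ∃ (H : LabelledDigraph n X) (K : Finset (Fin n)),
      (∀ i : Fin n, s ≤ i → H.label i = G.label i ∧ H.succ i = G.succ i) ∧
      (∀ i ∈ K, s + 1 - w.length ≤ (i : ℕ) ∧ (i : ℕ) < s) ∧
      H.coverings w (rootLabel w) K ≠ 0 := by
  induction w using FreeMagma.recOnMul generalizing G s with
  | ih1 x => exact ⟨G, ∅, fun _ _ => ⟨rfl, rfl⟩, by simp, by simp [coverings, rootLabel]⟩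
  | ih2 a b iha ihb =>
    change a.length + b.length ≤ s + 1 at hs
    have ha := a.length_pos
    have hb := b.length_pos
    obtain ⟨H₁, K₁, hH₁, hK₁, hc₁⟩ := ihb G s hsn (by omega)
    obtain ⟨H₂, K₂, hH₂, hK₂, hc₂⟩ := iha H₁ (s + 1 - b.length) (by omega) (by omega)
    -- the vertex below all those used so far becomes the root of the tree of `a`
    let p : Fin n := ⟨s + 1 - b.length - a.length, by omega⟩
    have hp : ∀ j ∈ K₂, p < j := fun j hj => by
      have := hK₂ j hj
      rw [Fin.lt_def]
      change s + 1 - b.length - a.length < _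
      omega
    have hne : ∀ i : Fin n, s + 1 - b.length - a.length + 1 ≤ i → i ≠ p := by
      rintro i hi rfl
      simp [p] at hi
    let H := H₂.update p (rootLabel a) K₂ hp
    have hH : ∀ i : Fin n, s + 1 - b.length - a.length + 1 ≤ i →
        H.label i = H₂.label i ∧ H.succ i = H₂.succ i := fun i hi =>
      ⟨Function.update_of_ne (hne i hi) _ _, Function.update_of_ne (hne i hi) _ _⟩
    have hpK : p ∉ K₁ := fun h => by
      have := (hK₁ p h).1
      simp only [p] at this
      omega
    refine ⟨H, insert p K₁, fun i hi => ?_, fun i hi => ?_, ?_⟩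
    · obtain ⟨h₁, h₂⟩ := hH i (by omega)
      obtain ⟨h₃, h₄⟩ := hH₂ i (by omega)
      obtain ⟨h₅, h₆⟩ := hH₁ i hi
      exact ⟨h₁.trans (h₃.trans h₅), h₂.trans (h₄.trans h₆)⟩
    · change s + 1 - (a.length + b.length) ≤ (i : ℕ) ∧ (i : ℕ) < s
      rcases Finset.mem_insert.1 hi with rfl | hi
      · simp only [p]
        omega
      · have := hK₁ i hi
        omega
    · refine (H.coverings_mul a b _ _).2 ⟨p, Finset.mem_insert_self _ _, ?_, ?_⟩
      · rw [show H.label p = rootLabel a from Function.update_self _ _ _,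
          show H.succ p = K₂ from Function.update_self _ _ _,
          coverings_congr hH a _ _ fun i hi => ?_]
        · exact hc₂
        · have := hK₂ i hi
          omega
      · rw [Finset.erase_insert hpK, coverings_congr (H := H₁) (s := s + 1 - b.length)
          (fun i hi => ?_) b _ _ fun i hi => (hK₁ i hi).1]
        · exact hc₁
        · obtain ⟨h₁, h₂⟩ := hH i (by omega)
          obtain ⟨h₃, h₄⟩ := hH₂ i hi
          exact ⟨h₁.trans h₃, h₂.trans h₄⟩

theorem exists_coverings_vertex_ne_zero (w : FreeMagma X) (hw : w.length ≤ n) :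
    ∃ (H : LabelledDigraph n X) (p : Fin n), H.coverings w (H.label p) (H.succ p) ≠ 0 := by
  have hpos := w.length_pos
  obtain ⟨H, K, -, hK, hc⟩ := exists_coverings_ne_zero w
    (⟨fun _ => rootLabel w, fun _ => ∅, by simp⟩ : LabelledDigraph n X) n le_rfl (by omega)
  let p : Fin n := ⟨n - w.length, by omega⟩
  refine ⟨H.update p (rootLabel w) K fun j hj => ?_, p, ?_⟩
  · have := hK j hj
    rw [Fin.lt_def]
    change n - w.length < _
    omega
  · rw [show (H.update p (rootLabel w) K _).label p = rootLabel w from Function.update_self _ _ _,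
      show (H.update p (rootLabel w) K _).succ p = K from Function.update_self _ _ _,
      coverings_congr (H := H) (s := n - w.length + 1) (fun i hi => ?_)]
    · exact hc
    · intro i hi
      have := hK i hi
      omega
    · have hne : i ≠ p := by
        rintro rfl
        simp [p] at hi
      exact ⟨Function.update_of_ne hne _ _, Function.update_of_ne hne _ _⟩

end LabelledDigraph

/-! ### Evaluation on strongly triangular derivations -/

namespace LabelledDigraph

open MvPolynomial LSWitt FreeLeftSymmetric

variable {k X : Type*} [Field k] {n : ℕ}

theorem pderiv_prod_X_of_notMem {i : Fin n} {K : Finset (Fin n)} (h : i ∉ K) :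
    pderiv i (∏ j ∈ K, (MvPolynomial.X j : MvPolynomial (Fin n) k)) = 0 := by
  induction K using Finset.induction_on with
  | empty => simp
  | insert a s ha ih =>
    rw [Finset.mem_insert, not_or] at h
    rw [Finset.prod_insert ha, Derivation.leibniz, ih h.2, pderiv_X_of_ne (Ne.symm h.1)]
    simp

theorem pderiv_prod_X_of_mem {i : Fin n} {K : Finset (Fin n)} (h : i ∈ K) :
    pderiv i (∏ j ∈ K, (MvPolynomial.X j : MvPolynomial (Fin n) k)) =
      ∏ j ∈ K.erase i, MvPolynomial.X j := by
  rw [← Finset.mul_prod_erase K _ h, Derivation.leibniz, pderiv_X_self,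
    pderiv_prod_X_of_notMem (Finset.notMem_erase i K)]
  simp

variable (k) in
open scoped Classical in
/-- The polynomial attached to the letter `x` at a vertex labelled `y` with set of successors `K`:
the product of the variables indexed by `K` if `x = y`, and zero otherwise. -/
def vertexPoly (y : X) (K : Finset (Fin n)) (x : X) : MvPolynomial (Fin n) k :=
  if x = y then ∏ j ∈ K, MvPolynomial.X j else 0

theorem pderiv_vertexPoly_of_mem {i : Fin n} {K : Finset (Fin n)} (h : i ∈ K) (y x : X) :
    pderiv i (vertexPoly k y K x) = vertexPoly k y (K.erase i) x := by
  unfold vertexPoly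
  split_ifs
  · exact pderiv_prod_X_of_mem h
  · exact map_zero _

theorem pderiv_vertexPoly_of_notMem {i : Fin n} {K : Finset (Fin n)} (h : i ∉ K) (y x : X) :
    pderiv i (vertexPoly k y K x) = 0 := by
  unfold vertexPoly
  split_ifs
  · exact pderiv_prod_X_of_notMem h
  · exact map_zero _

theorem constantCoeff_vertexPoly (y x : X) (K : Finset (Fin n)) [Decidable (x = y ∧ K = ∅)] :
    constantCoeff (vertexPoly k y K x) = if x = y ∧ K = ∅ then 1 else 0 := by
  unfold vertexPoly
  rcases eq_or_ne x y with h | h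
  · rcases K.eq_empty_or_nonempty with hK | hK
    · simp [h, hK]
    · simp [h, hK.ne_empty, map_prod, Finset.prod_const, hK.card_ne_zero]
  · simp [h]

variable (G : LabelledDigraph n X)

variable (k) in
/-- The derivation substituted for the letter `x`: the sum of `(∏_{j ∈ succ i} xⱼ) ∂ᵢ` over the
vertices `i` with label `x`. -/
def derivation (x : X) : LSWitt k n := ofCoeff fun i => vertexPoly k (G.label i) (G.succ i) x

theorem derivation_mem (x : X) : G.derivation k x ∈ StronglyTriangular k n := by
  change _ ∈ Submodule.span k (stGenerators k n)
  have hsum : G.derivation k x = ∑ i, single (vertexPoly k (G.label i) (G.succ i) x) i := by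
    ext j : 1
    have : (∑ i, single (vertexPoly k (G.label i) (G.succ i) x) i).coeff j
        = ∑ i, (single (vertexPoly k (G.label i) (G.succ i) x) i).coeff j :=
      map_sum (⟨⟨fun D : LSWitt k n => D.coeff j, LSWitt.coeff_zero j⟩,
        fun D E => LSWitt.coeff_add D E j⟩ : LSWitt k n →+ MvPolynomial (Fin n) k) _ _
    rw [this, Finset.sum_eq_single j]
    · simp [derivation]
    · intro i _ hij
      simp [Pi.single_eq_of_ne hij.symm]
    · simp
  rw [hsum]
  refine Submodule.sum_mem _ fun i _ => ?_
  unfold vertexPoly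
  split_ifs
  · refine Submodule.subset_span ⟨i, ∑ j ∈ G.succ i, Finsupp.single j 1, fun j hj => ?_, ?_⟩
    · rw [Finsupp.finsetSum_apply] at hj
      obtain ⟨l, hl, hlj⟩ := Finset.exists_ne_zero_of_sum_ne_zero hj
      obtain rfl : l = j := by
        by_contra h
        exact hlj (Finsupp.single_eq_of_ne (Ne.symm h))
      exact G.lt_of_mem i l hl
    · rw [monomial_sum_one]
      rfl
  · convert zero_mem (Submodule.span k (stGenerators k n))
    ext j : 1
    simp

/-- Substituting the derivations of `G` into a tree and evaluating at the origin counts coverings: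
the variable `xⱼ` in the coefficient at a vertex survives only if it is differentiated by the
derivation at `j`. -/
theorem constantCoeff_symbol_tree (φ : FreeLeftSymmetric k X →ₙₐ[k] LSWitt k n)
    (hφ : ∀ x, φ (of k x) = G.derivation k x) (w : FreeMagma X) (y : X) (K : Finset (Fin n)) :
    constantCoeff (symbol φ (vertexPoly k y K) (tree w)) = G.coverings w y K := by
  classical
  induction w using FreeMagma.recOnMul generalizing y K with
  | ih1 x =>
    change constantCoeff (symbol φ (vertexPoly k y K) (of k x)) = _
    rw [symbol_of, constantCoeff_vertexPoly]
    simp [coverings]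
  | ih2 v w hv hw =>
    change _ = ((∑ i ∈ K, G.coverings v (G.label i) (G.succ i) * G.coverings w y (K.erase i) : ℕ)
      : k)
    rw [tree_mul, symbol_graft, map_sum, Nat.cast_sum,
      ← Finset.sum_subset (Finset.subset_univ K) fun i _ hi => ?_]
    · refine Finset.sum_congr rfl fun i hi => ?_
      rw [map_mul, Nat.cast_mul, ← hv, ← hw, ← symbol_coeff]
      simp only [hφ, derivation, coeff_ofCoeff, pderiv_vertexPoly_of_mem hi]
    · simp only [pderiv_vertexPoly_of_notMem hi, symbol_zero, mul_zero, map_zero]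

theorem constantCoeff_coeff_tree (φ : FreeLeftSymmetric k X →ₙₐ[k] LSWitt k n)
    (hφ : ∀ x, φ (of k x) = G.derivation k x) (w : FreeMagma X) (p : Fin n) :
    constantCoeff ((φ (tree w)).coeff p) = G.coverings w (G.label p) (G.succ p) := by
  rw [← constantCoeff_symbol_tree G φ hφ, ← symbol_coeff]
  simp only [hφ, derivation, coeff_ofCoeff]

end LabelledDigraph

theorem Submodule.eq_zero_of_mem_span_of_separated {k V : Type*} [Field k] [AddCommGroup V]
    [Module k V] {B : Set V} {g : V} (hg : g ∈ Submodule.span k B)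
    (h : ∀ b ∈ B, ∃ f : V →ₗ[k] k, f g = 0 ∧ f b ≠ 0 ∧ ∀ c ∈ B, f c ≠ 0 → c = b) : g = 0 := by
  obtain ⟨c, hc, rfl⟩ := Submodule.mem_span_set.1 hg
  suffices c = 0 by simp [this]
  ext b
  by_contra hb
  have hbs : b ∈ c.support := Finsupp.mem_support_iff.2 hb
  obtain ⟨f, hf, hfb, hfc⟩ := h b (hc hbs)
  rw [Finsupp.sum, map_sum, Finset.sum_eq_single_of_mem b hbs fun d hd hdb => ?_, map_smul,
    smul_eq_mul] at hf
  · exact (mul_ne_zero hb hfb) hf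
  · rw [map_smul, by_contra fun h0 => hdb (hfc d (hc hd) h0), smul_zero]

namespace FreeLeftSymmetric

theorem degreeLE_mono {R X : Type*} [CommRing R] : Monotone (degreeLE R X) := fun _ _ h =>
  Submodule.span_mono fun _ ⟨w, hw, e⟩ => ⟨w, hw.trans h, e⟩

theorem exists_mem_degreeLE {R X : Type*} [CommRing R] (g : FreeLeftSymmetric R X) :
    ∃ d, g ∈ degreeLE R X d := by
  have hg : g ∈ Submodule.span R (Set.range (word R : FreeMagma X → _)) := by
    rw [span_range_word]; trivial
  induction hg using Submodule.span_induction with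
  | mem _ h =>
    obtain ⟨w, rfl⟩ := h
    exact ⟨w.length, Submodule.subset_span ⟨w, le_rfl, rfl⟩⟩
  | zero => exact ⟨0, zero_mem _⟩
  | add u v _ _ hu hv =>
    obtain ⟨c, hc⟩ := hu
    obtain ⟨d, hd⟩ := hv
    exact ⟨max c d, add_mem (degreeLE_mono (le_max_left c d) hc)
      (degreeLE_mono (le_max_right c d) hd)⟩
  | smul t u _ hu =>
    obtain ⟨d, hd⟩ := hu
    exact ⟨d, Submodule.smul_mem _ t hd⟩

theorem mem_degreeLE_degree {R X : Type*} [CommRing R] (g : FreeLeftSymmetric R X) :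
    g ∈ degreeLE R X g.degree :=
  Nat.sInf_mem (s := {d | g ∈ degreeLE R X d}) (exists_mem_degreeLE g)

variable {k X : Type*} [Field k] {n : ℕ}

theorem eq_zero_of_mem_degreeLE [CharZero k] {g : FreeLeftSymmetric k X}
    (hd : g ∈ degreeLE k X n) (hg : g.IsIdentityOf (StronglyTriangular k n)) : g = 0 := by
  refine Submodule.eq_zero_of_mem_span_of_separated (degreeLE_le_span_tree n hd) ?_
  rintro _ ⟨w, hw, rfl⟩
  obtain ⟨G, p, hp⟩ := LabelledDigraph.exists_coverings_vertex_ne_zero w hw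
  let ψ : FreeLeftSymmetric k X →ₙₐ[k] StronglyTriangular k n :=
    lift k fun x => ⟨G.derivation k x, G.derivation_mem x⟩
  let φ : FreeLeftSymmetric k X →ₙₐ[k] LSWitt k n :=
    (NonUnitalSubalgebraClass.subtype (StronglyTriangular k n)).comp ψ
  have hφ : ∀ x, φ (of k x) = G.derivation k x := fun x =>
    congrArg Subtype.val (lift_of k (A := StronglyTriangular k n) _ x)
  have hφg : φ g = 0 := congrArg Subtype.val (hg _)
  have key := G.constantCoeff_coeff_tree φ hφ
  refine ⟨
    { toFun := fun u => MvPolynomial.constantCoeff ((φ u).coeff p)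
      map_add' := fun u v => by rw [map_add, LSWitt.coeff_add, map_add]
      map_smul' := fun t u => by
        rw [map_smul, LSWitt.coeff_smul, MvPolynomial.smul_eq_C_mul, map_mul,
          MvPolynomial.constantCoeff_C]
        rfl }, ?_, ?_, ?_⟩
  · change MvPolynomial.constantCoeff ((φ g).coeff p) = 0
    rw [hφg, LSWitt.coeff_zero, map_zero]
  · change MvPolynomial.constantCoeff ((φ (tree w)).coeff p) ≠ 0
    rw [key]
    exact Nat.cast_ne_zero.2 hp
  · rintro _ ⟨v, -, rfl⟩ hv
    change MvPolynomial.constantCoeff ((φ (tree v)).coeff p) ≠ 0 at hv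
    rw [key, Nat.cast_ne_zero] at hv
    exact G.tree_eq_tree k v w _ _ hv hp

end FreeLeftSymmetric

/-! ### Nilpotency of right multiplications -/

namespace LSWitt

open MvPolynomial

variable {k : Type*} [Field k] {n : ℕ}

theorem pderiv_coeff_eq_zero {D : LSWitt k n} (hD : D ∈ StronglyTriangular k n) {i j : Fin n}
    (hij : i ≤ j) : pderiv i (D.coeff j) = 0 := by
  change D ∈ Submodule.span k (stGenerators k n) at hD
  induction hD using Submodule.span_induction with
  | mem _ h =>
    obtain ⟨l, s, hs, rfl⟩ := h
    rw [coeff_single]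
    rcases eq_or_ne j l with rfl | hjl
    · have : s i = 0 := by
        by_contra h
        exact (hs i h).not_ge hij
      simp [pderiv_monomial, this]
    · simp [Pi.single_eq_of_ne hjl]
  | zero => simp
  | add D E _ _ hD hE => rw [LSWitt.coeff_add, map_add, hD, hE, add_zero]
  | smul t D _ hD => rw [LSWitt.coeff_smul, Derivation.map_smul, hD, smul_zero]

/-- Each right multiplication by a strongly triangular derivation makes the last possibly nonzero
coefficient vanish. -/
theorem coeff_prod_mulRight_eq_zero (l : List (LSWitt k n))
    (hl : ∀ D ∈ l, D ∈ StronglyTriangular k n)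
    (E : LSWitt k n) (j : Fin n) (hj : n ≤ j + l.length) :
    ((l.map (LinearMap.mulRight k)).prod E).coeff j = 0 := by
  induction l generalizing j with
  | nil =>
    have := j.isLt
    simp only [List.length_nil] at hj
    omega
  | cons D l ih =>
    simp only [List.length_cons] at hj
    rw [List.map_cons, List.prod_cons, Module.End.mul_apply, LinearMap.mulRight_apply,
      LSWitt.coeff_mul, toDer_apply]
    refine Finset.sum_eq_zero fun i _ => ?_
    rcases le_or_gt i j with hij | hij
    · rw [pderiv_coeff_eq_zero (hl D List.mem_cons_self) hij, mul_zero]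
    · rw [ih (fun D hD => hl D (List.mem_cons_of_mem _ hD)) i, zero_mul]
      rw [Fin.lt_def] at hij
      omega

end LSWitt

namespace FreeLeftSymmetric

variable {k : Type*}

theorem map_prod_mulRight {R A : Type*} [CommRing R] [LeftPreLieRing A] [LeftPreLieAlgebra R A]
    (ψ : FreeLeftSymmetric R X →ₙₐ[R] A) (l : List (FreeLeftSymmetric R X))
    (v : FreeLeftSymmetric R X) :
    ψ ((l.map (LinearMap.mulRight R)).prod v) =
      ((l.map ψ).map (LinearMap.mulRight R)).prod (ψ v) := by
  induction l with
  | nil => rfl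
  | cons u l ih =>
    simp only [List.map_cons, List.prod_cons, Module.End.mul_apply, LinearMap.mulRight_apply,
      map_mul, ih]

theorem rightNil_eq (R : Type*) [CommRing R] (n : ℕ) : rightNil R n =
    ((List.ofFn fun i : Fin n => of R i.castSucc).map (LinearMap.mulRight R)).prod
      (of R (Fin.last n)) := by
  rw [List.map_ofFn]
  rfl

theorem rightNil_mem_degreeLE (R : Type*) [CommRing R] (n : ℕ) :
    rightNil R n ∈ degreeLE R (Fin (n + 1)) (n + 1) := by
  have key : ∀ (l : List (Fin (n + 1))) (z : Fin (n + 1)), ∃ w : FreeMagma (Fin (n + 1)),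
      w.length = l.length + 1 ∧
        ((l.map (of R)).map (LinearMap.mulRight R)).prod (of R z) = word R w := by
    intro l z
    induction l with
    | nil => exact ⟨.of z, rfl, rfl⟩
    | cons y l ih =>
      obtain ⟨w, hw, h⟩ := ih
      refine ⟨w * .of y, ?_, ?_⟩
      · change w.length + 1 = _
        rw [hw, List.length_cons]
      · rw [List.map_cons, List.map_cons, List.prod_cons, Module.End.mul_apply, h,
          LinearMap.mulRight_apply, word_mul, word_of]
  obtain ⟨w, hw, h⟩ := key (List.ofFn Fin.castSucc) (Fin.last n)
  rw [List.length_ofFn] at hw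
  refine Submodule.subset_span ⟨w, hw.le, ?_⟩
  rw [← h, rightNil_eq]
  simp only [List.map_ofFn, Function.comp_def]

theorem rightNil_isIdentityOf [Field k] (n : ℕ) :
    (rightNil k n).IsIdentityOf (StronglyTriangular k n) := by
  intro a
  let φ : FreeLeftSymmetric k (Fin (n + 1)) →ₙₐ[k] LSWitt k n :=
    (NonUnitalSubalgebraClass.subtype (StronglyTriangular k n)).comp (lift k a)
  refine Subtype.ext ?_
  change φ (rightNil k n) = 0
  ext j : 1
  rw [rightNil_eq, map_prod_mulRight, LSWitt.coeff_zero]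
  refine LSWitt.coeff_prod_mulRight_eq_zero _ (fun D hD => ?_) _ j (by simp)
  obtain ⟨u, -, rfl⟩ := List.mem_map.1 hD
  exact (lift k a u).2

/-- All variables are replaced by the idempotent `x ∂` of the Witt algebra of index one. -/
theorem rightNil_ne_zero [Field k] (n : ℕ) : rightNil k n ≠ 0 := by
  intro h
  let e : LSWitt k 1 := LSWitt.single (MvPolynomial.X 0) 0
  have he : e * e = e := by
    rw [LSWitt.single_mul_single, MvPolynomial.pderiv_X_self, mul_one]
  have key : ∀ l : List (LSWitt k 1), (∀ D ∈ l, D = e) →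
      (l.map (LinearMap.mulRight k)).prod e = e := by
    intro l hl
    induction l with
    | nil => rfl
    | cons D l ih =>
      rw [List.map_cons, List.prod_cons, Module.End.mul_apply,
        ih fun D hD => hl D (List.mem_cons_of_mem _ hD), LinearMap.mulRight_apply,
        hl D List.mem_cons_self, he]
  have h0 := congrArg (lift k fun _ : Fin (n + 1) => e) h
  rw [rightNil_eq, map_prod_mulRight, lift_of, map_zero, key] at h0
  · have := congrArg (fun D : LSWitt k 1 => D.coeff 0) h0
    simp [e, MvPolynomial.X_ne_zero] at this
  · intro D hD
    obtain ⟨u, hu, rfl⟩ := List.mem_map.1 hD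
    obtain ⟨i, rfl⟩ := (List.mem_ofFn' _ _).1 hu
    exact lift_of k _ _

end FreeLeftSymmetric

end

theorem corollary7 (k : Type*) [Field k] [CharZero k] (n : ℕ) :
    (FreeLeftSymmetric.rightNil k n).IsIdentityOf (StronglyTriangular k n) ∧
    FreeLeftSymmetric.rightNil k n ≠ 0 ∧
    (FreeLeftSymmetric.rightNil k n).degree = n + 1 ∧
    ∀ (m : ℕ) (g : FreeLeftSymmetric k (Fin m)),
      g ≠ 0 → g.IsIdentityOf (StronglyTriangular k n) → n + 1 ≤ g.degree := by
  have minimal : ∀ (m : ℕ) (g : FreeLeftSymmetric k (Fin m)),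
      g ≠ 0 → g.IsIdentityOf (StronglyTriangular k n) → n + 1 ≤ g.degree := by
    intro m g hg hid
    by_contra! h
    exact hg (FreeLeftSymmetric.eq_zero_of_mem_degreeLE (FreeLeftSymmetric.degreeLE_mono
      (Nat.le_of_lt_succ h) (FreeLeftSymmetric.mem_degreeLE_degree g)) hid)
  have hid := FreeLeftSymmetric.rightNil_isIdentityOf (k := k) n
  have hne := FreeLeftSymmetric.rightNil_ne_zero (k := k) n
  exact ⟨hid, hne, le_antisymm (Nat.sInf_le (FreeLeftSymmetric.rightNil_mem_degreeLE k n))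
    (minimal _ _ hne hid), minimal⟩
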